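/- All games have length $\omega$, and strategies use perfect information: the player's move is a function of the finite sequence of all the opponent's moves made so far. For a set $Y$ and families $\mathcal A,\mathcal B$ of subsets of $Y$, let $G_1(\mathcal A,\mathcal B)$ be the game in which, in each round $n<\omega$, player I chooses $A_n\in\mathcal A$ and then player II chooses $b_n\in A_n$; II wins if $\{b_n:n<\omega\}\in\mathcal B$, and I wins otherwise. For a topological space $X$ let $\mathcal O_X$ be the set of open covers of $X$, let $\Omega_X$ be the set of $\omega$-covers of $X$ (open covers $\mathcal U$ such that every finite $F\subseteq X$ is contained in some $U\in\mathcal U$), let $\Omega_{X,x}=\{A\subseteq X: x\in\overline A\}$ for $x\in X$, and let $\mathcal D_X$ be the set of dense subsets of $X$. Let $C_p(X)$ be the space of continuous functions $X\to\mathbb R$ with the topology of pointwise convergence, and let $\mathbf 0$ be the zero function. In the following games player I moves first in each round. - $PO(X)$: I plays a point $x_n\in X$, II plays an open set $U_n\ni x_n$; I wins if $\bigcup_n U_n=X$. - $FO(X)$: I plays a finite set $F_n\subseteq X$, II plays an open set $U_n\supseteq F_n$; I wins if $\bigcup_n U_n=X$. - $\Omega FO(X)$: the moves are those of $FO(X)$;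 I wins if $\{U_n:n<\omega\}$ is an $\omega$-cover of $X$. - $Gru_{\to}(X,x)$ (Gruenhage's $W$-game): I plays an open set $U_n\ni x$, II plays a point $x_n\in U_n$; I wins if $x_n\to x$. - $Gru_{\leadsto}(X,x)$ (the clustering game): the moves are those of $Gru_{\to}(X,x)$; I wins if $x$ is a cluster point of the sequence $(x_n)$, that is, if every neighbourhood of $x$ contains $x_n$ for infinitely many $n$. - $CL(X,x)$ (the closure game): I plays a nonempty open set $U_n\subseteq X$, II plays a point $x_n\in U_n$; I wins if $x\in\overline{\{x_n:n<\omega\}}$. - $CD(X)$ (the discrete selection game): the moves are those of $CL(X,x)$; II wins if the set $\{x_n:n<\omega\}$ is closed and discrete, and I wins otherwise. **Theorem.** Let $X$ be a nonempty Tychonoff ($T_{3.5}$) space. The following are equivalent. (a) II has a winning strategy in the Rothberger game $G_1(\mathcal O_X,\mathcal O_X)$. (b) II has a winning strategy in $G_1(\Omega_X,\Omega_X)$. (c) I has a winning strategy in $PO(X)$. (d) I has a winning strategy in $FO(X)$. (e) I has a winning strategy in $\Omega FO(X)$. (f) I has a winning strategy in $Gru_{\to}(C_p(X),\mathbf 0)$.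 (g) I has a winning strategy in $Gru_{\leadsto}(C_p(X),\mathbf 0)$. (h) I has a winning strategy in $CL(C_p(X),\mathbf 0)$. (i) I has a winning strategy in $CD(C_p(X))$. (j) II has a winning strategy in $G_1(\Omega_{C_p(X),\mathbf 0},\Omega_{C_p(X),\mathbf 0})$ (the strong countable fan tightness game). (k) II has a winning strategy in $G_1(\mathcal D_{C_p(X)},\Omega_{C_p(X),\mathbf 0})$ (the strong countable dense fan tightness game). -/

import Mathlib

open Set Filter Topology

/-- A game of length `ω`. In each round `n`, player I chooses a move `a n : A`
(`A` is the type of all legal moves of player I), and then player II answers with a move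
`b n : B` that must satisfy `legal (a n) (b n)`. Player I wins the play if `winI a b` holds,
and player II wins it otherwise. -/
structure OmegaGame (A B : Type*) where
  /-- the legal answers of player II to a move of player I -/
  legal : A → B → Prop
  /-- the plays that player I wins -/
  winI : (ℕ → A) → (ℕ → B) → Prop

namespace OmegaGame

/-- The list `⟨c 0, …, c (n - 1)⟩` of the first `n` moves of a player. -/
def history {C : Type*} (c : ℕ → C) (n : ℕ) : List C :=
  (List.range n).map c

/-- Player I has a winning strategy (with perfect information): there is a rule that gives the
next move of player I from the finite list of the previous moves of player II, and
that wins against all legal moves of player II. -/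
def WinsI {A B : Type*} (G : OmegaGame A B) : Prop :=
  ∃ σ : List B → A, ∀ b : ℕ → B,
    (∀ n, G.legal (σ (history b n)) (b n)) → G.winI (fun n => σ (history b n)) b

/-- Player II has a winning strategy (with perfect information): there is a rule that gives the
answer of player II from the finite list of the moves made by player I up to
and including the current round, and that is always legal and wins against all moves of
player I. -/
def WinsII {A B : Type*} (G : OmegaGame A B) : Prop :=
  ∃ σ : List A → B, ∀ a : ℕ → A,
    (∀ n, G.legal (a n) (σ (history a (n + 1)))) ∧
      ¬ G.winI a (fun n => σ (history a (n + 1)))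

end OmegaGame

/-- The strong selection game `G₁(𝒜, ℬ)`: in round `n` player I chooses `A n ∈ 𝒜`, and
player II chooses an element `b n ∈ A n`. Player II wins if `{b n : n ∈ ω} ∈ ℬ`. -/
def strongSelectionGame {Y : Type*} (𝒜 ℬ : Set (Set Y)) : OmegaGame 𝒜 Y where
  legal A b := b ∈ (A : Set Y)
  winI _ b := range b ∉ ℬ

section Families

variable (X : Type*) [TopologicalSpace X]

/-- The open covers of `X`. -/
def openCovers : Set (Set (Set X)) :=
  {𝒰 | (∀ U ∈ 𝒰, IsOpen U) ∧ ⋃₀ 𝒰 = univ}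

/-- The `ω`-covers of `X`: the open covers such that each finite subset of `X` is contained
in a single member of the cover. -/
def omegaCovers : Set (Set (Set X)) :=
  {𝒰 | 𝒰 ∈ openCovers X ∧ ∀ F : Finset X, ∃ U ∈ 𝒰, (F : Set X) ⊆ U}

/-- The sets that have `x` in their closure. -/
def blades {X : Type*} [TopologicalSpace X] (x : X) : Set (Set X) :=
  {A | x ∈ closure A}

/-- The dense subsets of `X`. -/
def denseSets : Set (Set X) :=
  {D | Dense D}

/-- The nonempty open subsets of `X`. -/
def nonemptyOpens : Set (Set X) :=
  {U | IsOpen U ∧ U.Nonempty}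

/-- The open subsets of `X` that contain `x`. -/
def openNhds {X : Type*} [TopologicalSpace X] (x : X) : Set (Set X) :=
  {U | IsOpen U ∧ x ∈ U}

end Families

section Games

variable (X : Type*) [TopologicalSpace X]

/-- The point-open game `PO(X)`: player I plays points, player II plays open sets containing
them, and player I wins if the open sets cover `X`. -/
def pointOpenGame : OmegaGame X (Set X) where
  legal x U := IsOpen U ∧ x ∈ U
  winI _ U := (⋃ n, U n) = univ

/-- The finite-open game `FO(X)`: player I plays finite sets, player II plays open sets
containing them, and player I wins if the open sets cover `X`. -/
def finiteOpenGame : OmegaGame (Finset X) (Set X) where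
  legal F U := IsOpen U ∧ (F : Set X) ⊆ U
  winI _ U := (⋃ n, U n) = univ

/-- The game `ΩFO(X)`: like the finite-open game, but player I wins if the open sets played by
player II form an `ω`-cover of `X`. -/
def omegaFiniteOpenGame : OmegaGame (Finset X) (Set X) where
  legal F U := IsOpen U ∧ (F : Set X) ⊆ U
  winI _ U := range U ∈ omegaCovers X

/-- Gruenhage's `W`-game at `x`: player I plays open sets containing `x`, player II plays points
of these sets, and player I wins if the points converge to `x`. -/
def gruenhageWGame {X : Type*} [TopologicalSpace X] (x : X) : OmegaGame (openNhds x) X where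
  legal U y := y ∈ (U : Set X)
  winI _ y := Tendsto y atTop (𝓝 x)

/-- Gruenhage's clustering game at `x`: like the `W`-game, but player I wins if `x` is a
cluster point of the sequence of points, that is, if each neighbourhood of `x` contains
the `n`-th point for infinitely many `n`. -/
def gruenhageClusterGame {X : Type*} [TopologicalSpace X] (x : X) :
    OmegaGame (openNhds x) X where
  legal U y := y ∈ (U : Set X)
  winI _ y := MapClusterPt x atTop y

/-- The closure game `CL(X, x)`: player I plays nonempty open sets, player II plays points of
these sets, and player I wins if `x` is in the closure of the set of these points. -/
def closureGame {X : Type*} [TopologicalSpace X] (x : X) : OmegaGame (nonemptyOpens X) X where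
  legal U y := y ∈ (U : Set X)
  winI _ y := x ∈ closure (range y)

/-- The discrete selection game `CD(X)`: player I plays nonempty open sets, player II plays
points of these sets, and player II wins if the set of these points is closed and discrete. -/
def discreteSelectionGame : OmegaGame (nonemptyOpens X) X where
  legal U y := y ∈ (U : Set X)
  winI _ y := ¬ (IsClosed (range y) ∧ DiscreteTopology (range y))

/-- The space `C_p(X)` of all continuous real-valued functions on `X` with the topology of
pointwise convergence, that is, the topology of a subspace of the product `X → ℝ`. -/
abbrev Cp : Type _ := {f : X → ℝ // Continuous f}

/-- The zero function as a point of `C_p(X)`. -/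
def cpZero : Cp X := ⟨fun _ => 0, continuous_const⟩

end Games

/-! All conditions reduce to player I winning the finite-open game. Galvin's duality
(`strongSelectionGame_winsII_iff`) turns a winning strategy of II in a selection game into one of I
in a game of points or open sets; this links (a) with (c), (b) with (e), and (k) with (h).

A strategy of I in the finite-open game becomes stronger if I answers all subsequences of the past
moves at once: each point then lies in all but finitely many of II's sets
(`finiteOpen_winsI_gamma`). This yields an `ω`-cover and, with the sets where `|f| < 1/(n+1)`,
convergence to zero in `C_p(X)`. From convergence the implications descend through clustering, (j),
(k) and the closure game to discrete selection.

The circle closes in `discrete_winsI_finiteOpen`: an open set of functions constrains only finitely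
many points, so by complete regularity II may pick a function in it with value `n` outside any open
`U n` containing these points. A point missed by all `U n` would make these functions closed and
discrete. -/

namespace OmegaGame

/-! ### Histories and transfer of strategies. -/

variable {A B A' B' S : Type*}

theorem history_zero (c : ℕ → A) : history c 0 = [] := rfl

theorem history_succ (c : ℕ → A) (n : ℕ) : history c (n + 1) = history c n ++ [c n] := by
  simp [history, List.range_succ]

theorem length_history (c : ℕ → A) (n : ℕ) : (history c n).length = n := by
  simp [history]

theorem history_comp_sublist (c : ℕ → A) {k : ℕ → ℕ} (hk : StrictMono k) (n : ℕ) :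
    (history (c ∘ k) n).Sublist (history c (k n)) := by
  have mono : ∀ {m p : ℕ}, m ≤ p → (history c m).Sublist (history c p) := fun h =>
    (List.range_sublist.2 h).map c
  induction n with
  | zero => simp [history_zero]
  | succ n ih =>
    rw [history_succ]
    refine List.Sublist.trans ?_ (mono (Nat.succ_le_of_lt (hk n.lt_succ_self)))
    rw [history_succ]
    exact ih.append (List.Sublist.refl _)

/-- Dependent choice along finite lists. -/
theorem exists_history {R : List B → Prop} {P : List B → B → Prop} (h0 : R [])
    (h : ∀ l, R l → ∃ b, R (l ++ [b]) ∧ P l b) :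
    ∃ b : ℕ → B, ∀ n, P (history b n) (b n) := by
  choose f hf using h
  let t : ℕ → {l // R l} := fun n =>
    Nat.rec ⟨[], h0⟩ (fun _ l => ⟨l.1 ++ [f l.1 l.2], (hf l.1 l.2).1⟩) n
  refine ⟨fun n => f (t n).1 (t n).2, fun n => ?_⟩
  have ht : ∀ n, history (fun n => f (t n).1 (t n).2) n = (t n).1 := by
    intro n
    induction n with
    | zero => rfl
    | succ n ih => rw [history_succ, ih]
  rw [ht]
  exact (hf _ _).2

/-- A winning strategy of player I that keeps track of a state. -/
theorem WinsI.of_state {G : OmegaGame A B} (s₀ : S) (step : S → B → S) (move : S → A)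
    (h : ∀ (b : ℕ → B) (s : ℕ → S), s 0 = s₀ → (∀ n, s (n + 1) = step (s n) (b n)) →
      (∀ n, G.legal (move (s n)) (b n)) → G.winI (fun n => move (s n)) b) :
    G.WinsI := by
  refine ⟨fun l => move (l.foldl step s₀), fun b hb => ?_⟩
  refine h b (fun n => (history b n).foldl step s₀) rfl (fun n => ?_) hb
  simp [history_succ]

/-- A winning strategy of player II that keeps track of a state. -/
theorem WinsII.of_state [Nonempty B] {G : OmegaGame A B} (s₀ : S) (step : S → A → S)
    (answer : S → A → B)
    (h : ∀ (a : ℕ → A) (s : ℕ → S), s 0 = s₀ → (∀ n, s (n + 1) = step (s n) (a n)) →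
      (∀ n, G.legal (a n) (answer (s n) (a n))) ∧
        ¬ G.winI a (fun n => answer (s n) (a n))) :
    G.WinsII := by
  classical
  refine ⟨fun l => if hl : l ≠ [] then answer (l.dropLast.foldl step s₀) (l.getLast hl)
    else Classical.arbitrary B, fun a => ?_⟩
  have := h a (fun n => (history a n).foldl step s₀) rfl (fun n => by simp [history_succ])
  simpa [history_succ] using this

/-- Transfer of winning strategies of player I: `φ` translates the moves of player I and `ψ`
translates the answers of player II back. -/
theorem WinsI.transfer {G : OmegaGame A B} {G' : OmegaGame A' B'} (hG : G.WinsI)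
    (φ : ℕ → A → A') (ψ : ℕ → A → B' → B)
    (hlegal : ∀ n a b, G'.legal (φ n a) b → G.legal a (ψ n a b))
    (hwin : ∀ a b, (∀ n, G'.legal (φ n (a n)) (b n)) →
      G.winI a (fun n => ψ n (a n) (b n)) → G'.winI (fun n => φ n (a n)) b) :
    G'.WinsI := by
  obtain ⟨σ, hσ⟩ := hG
  -- The state is the history of II's translated answers in `G`; its length is the round number.
  refine WinsI.of_state ([] : List B) (fun s b => s ++ [ψ s.length (σ s) b])
    (fun s => φ s.length (σ s)) fun b s h0 hs hb => ?_
  have key : ∀ n, s n = history (fun n => ψ (s n).length (σ (s n)) (b n)) n := by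
    intro n
    induction n with
    | zero => rw [h0, history_zero]
    | succ n ih => rw [history_succ, ← ih, hs]
  have hlen : ∀ n, (s n).length = n := fun n => by rw [key n, length_history]
  simp only [hlen] at key hb ⊢
  refine hwin (fun n => σ (s n)) b hb ?_
  have := hσ (fun n => ψ n (σ (s n)) (b n))
  simp only [← key] at this
  exact this fun n => hlegal _ _ _ (hb n)

/-- If finitely many moves of player I can be combined into a single one, then a winning strategy
of player I can be improved so that all subsequences of the answers of player II are lost for
player II. -/
theorem WinsI.exists_forall_subseq {G : OmegaGame A B} (hG : G.WinsI) (comb : List A → A)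
    (hcomb : ∀ l b, G.legal (comb l) b → ∀ a ∈ l, G.legal a b) :
    ∃ σ : List B → A, ∀ b : ℕ → B, (∀ n, G.legal (σ (history b n)) (b n)) →
      ∀ k : ℕ → ℕ, StrictMono k → ∃ a, G.winI a (b ∘ k) := by
  obtain ⟨σ, hσ⟩ := hG
  -- Player I combines the answers of `σ` to all sublists of the history, so every subsequence of
  -- II's moves is a legal play against `σ`.
  refine ⟨fun l => comb (l.sublists.map σ), fun b hb k hk => ⟨_, hσ (b ∘ k) fun n => ?_⟩⟩
  refine hcomb _ _ (hb (k n)) _ (List.mem_map_of_mem ?_)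
  exact List.mem_sublists.2 (history_comp_sublist b hk n)

/-- Legality is assumed only along infinite plays; a finite history is prolonged by repeating `x`.
-/
theorem legal_append_singleton {G : OmegaGame A B} {σ : List A → B}
    (hσ : ∀ a : ℕ → A, ∀ n, G.legal (a n) (σ (history a (n + 1)))) (l : List A) (x : A) :
    G.legal x (σ (l ++ [x])) := by
  have h := hσ (fun i => l.getD i x) l.length
  have e : history (fun i => l.getD i x) l.length = l := by
    apply List.ext_getElem
    · simp [history]
    · intro i h₁ h₂
      simp [history, h₂]
  rw [history_succ, e] at h
  simpa using h

end OmegaGame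

open OmegaGame

/-! ### Galvin's duality. -/

/-- The game dual to a strong selection game: player I plays (an index of) a set `R m`, player II
answers with one of its elements, and player I wins if the answers form a member of `ℬ`. -/
def reflectionGame {M Y : Type*} (R : M → Set Y) (ℬ : Set (Set Y)) : OmegaGame M Y where
  legal m y := y ∈ R m
  winI _ y := range y ∈ ℬ

/-- Galvin's duality: if `𝒜` is generated by the ranges of the choice functions of `R`, then
player II wins `G₁(𝒜, ℬ)` if and only if player I wins the dual game. -/
theorem strongSelectionGame_winsII_iff {M Y : Type*} {R : M → Set Y} {𝒜 ℬ : Set (Set Y)}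
    (hne : 𝒜.Nonempty) (hmeet : ∀ A ∈ 𝒜, ∀ m, (A ∩ R m).Nonempty)
    (hrange : ∀ f : M → Y, (∀ m, f m ∈ R m) → range f ∈ 𝒜) :
    (strongSelectionGame 𝒜 ℬ).WinsII ↔ (reflectionGame R ℬ).WinsI := by
  have : Nonempty 𝒜 := hne.to_subtype
  constructor
  · rintro ⟨σ, hσ⟩
    -- Otherwise each `R m` contains some `f m` that `σ` never answers after `s`; but `range f` is a
    -- legal move, and the answer to it is one of the `f m`.
    have hex : ∀ s : List 𝒜, ∃ m, ∀ y ∈ R m, ∃ A : 𝒜, σ (s ++ [A]) = y := by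
      intro s
      by_contra! hcon
      choose f hf hf' using hcon
      obtain ⟨m, hm⟩ : σ (s ++ [(⟨range f, hrange f hf⟩ : 𝒜)]) ∈ range f :=
        legal_append_singleton (G := strongSelectionGame 𝒜 ℬ) (fun a => (hσ a).1) s
          ⟨range f, hrange f hf⟩
      exact hf' m _ hm.symm
    choose m hm using hex
    have hex' : ∀ s y, ∃ A : 𝒜, y ∈ R (m s) → σ (s ++ [A]) = y := by
      intro s y
      by_cases hy : y ∈ R (m s)
      · obtain ⟨A, hA⟩ := hm s y hy
        exact ⟨A, fun _ => hA⟩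
      · exact ⟨Classical.arbitrary _, fun h => absurd h hy⟩
    choose A hA using hex'
    -- Each answer `y` is decoded as the reply of `σ` to a move `A s y`, so the play is one against
    -- `σ`.
    refine WinsI.of_state ([] : List 𝒜) (fun s y => s ++ [A s y]) m fun y s h0 hs hy => ?_
    have key : ∀ n, s n = history (fun n => A (s n) (y n)) n := by
      intro n
      induction n with
      | zero => rw [h0, history_zero]
      | succ n ih => rw [history_succ, ← ih, hs]
    have hwin := (hσ fun n => A (s n) (y n)).2
    have e : (fun n => σ (history (fun n => A (s n) (y n)) (n + 1))) = y := by
      funext n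
      rw [← key, hs]
      exact hA _ _ (hy n)
    rw [e] at hwin
    exact not_not.1 hwin
  · rintro ⟨τ, hτ⟩
    have : Nonempty Y := by
      obtain ⟨A, hA⟩ := hne
      exact ⟨(hmeet A hA (τ [])).some⟩
    have hex : ∀ (A : 𝒜) m, ∃ y, y ∈ (A : Set Y) ∧ y ∈ R m := fun A m => hmeet A A.2 m
    choose p hpA hpR using hex
    refine WinsII.of_state ([] : List Y) (fun s A => s ++ [p A (τ s)]) (fun s A => p A (τ s))
      fun a s h0 hs => ⟨fun n => hpA _ _, not_not.2 ?_⟩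
    have key : ∀ n, s n = history (fun n => p (a n) (τ (s n))) n := by
      intro n
      induction n with
      | zero => rw [h0, history_zero]
      | succ n ih => rw [history_succ, ← ih, hs]
    refine hτ (fun n => p (a n) (τ (s n))) fun n => ?_
    rw [← key]
    exact hpR _ _

/-! ### Selection games on covers and their duals. -/

section Covers

variable (X : Type*) [TopologicalSpace X]

theorem rothberger_winsII_iff :
    (strongSelectionGame (openCovers X) (openCovers X)).WinsII ↔ (pointOpenGame X).WinsI := by
  rw [strongSelectionGame_winsII_iff (R := fun x : X => {U | IsOpen U ∧ x ∈ U})]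
  · constructor
    · intro h
      refine h.transfer (fun _ x => x) (fun _ _ U => U) (fun _ _ _ h => h) fun a U _ hw => ?_
      have : ⋃₀ range U = univ := hw.2
      rwa [sUnion_range] at this
    · intro h
      refine h.transfer (fun _ x => x) (fun _ _ U => U) (fun _ _ _ h => h) fun a U hU hw => ?_
      refine ⟨forall_mem_range.2 fun n => (hU n).1, ?_⟩
      rw [sUnion_range]
      exact hw
  · exact ⟨{univ}, by simp [openCovers]⟩
  · rintro 𝒰 ⟨ho, hc⟩ x
    obtain ⟨U, hU, hx⟩ := mem_sUnion.1 (hc ▸ mem_univ x)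
    exact ⟨U, hU, ho U hU, hx⟩
  · intro f hf
    refine ⟨forall_mem_range.2 fun x => (hf x).1, eq_univ_of_forall fun x => ?_⟩
    exact mem_sUnion.2 ⟨f x, mem_range_self x, (hf x).2⟩

theorem omega_rothberger_winsII_iff :
    (strongSelectionGame (omegaCovers X) (omegaCovers X)).WinsII ↔
      (omegaFiniteOpenGame X).WinsI := by
  refine strongSelectionGame_winsII_iff
    (R := fun F : Finset X => {U | IsOpen U ∧ (F : Set X) ⊆ U}) ?_ ?_ ?_
  · exact ⟨{univ}, by simp [omegaCovers, openCovers]⟩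
  · rintro 𝒰 ⟨ho, hc⟩ F
    obtain ⟨U, hU, hF⟩ := hc F
    exact ⟨U, hU, ho.1 U hU, hF⟩
  · intro f hf
    refine ⟨⟨forall_mem_range.2 fun x => (hf x).1, eq_univ_of_forall fun x => ?_⟩,
      fun F => ⟨f F, mem_range_self F, (hf F).2⟩⟩
    exact mem_sUnion.2 ⟨f {x}, mem_range_self _, (hf {x}).2 (by simp)⟩

end Covers

/-! ### Closure, clustering and discrete selection. -/

section Closure

variable {X : Type*} [TopologicalSpace X] (x : X)

theorem blades_winsII_iff (ℬ : Set (Set X)) :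
    (strongSelectionGame (blades x) ℬ).WinsII ↔
      (reflectionGame (fun U : openNhds x => (U : Set X)) ℬ).WinsI := by
  refine strongSelectionGame_winsII_iff ⟨{x}, subset_closure rfl⟩ ?_ ?_
  · rintro A hA ⟨U, hU, hx⟩
    rw [inter_comm]
    exact mem_closure_iff.1 hA U hU hx
  · intro f hf
    refine mem_closure_iff.2 fun U hU hx => ?_
    exact ⟨f ⟨U, hU, hx⟩, hf ⟨U, hU, hx⟩, mem_range_self _⟩

theorem denseSets_winsII_iff :
    (strongSelectionGame (denseSets X) (blades x)).WinsII ↔ (closureGame x).WinsI := by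
  refine strongSelectionGame_winsII_iff
    (R := fun U : nonemptyOpens X => (U : Set X)) ⟨univ, dense_univ⟩ ?_ ?_
  · rintro A hA ⟨U, hU, hne⟩
    rw [inter_comm]
    exact hA.inter_open_nonempty U hU hne
  · intro f hf
    refine dense_iff_inter_open.2 fun U hU hne => ?_
    exact ⟨f ⟨U, hU, hne⟩, hf ⟨U, hU, hne⟩, mem_range_self _⟩

theorem cluster_winsI_blades (h : (gruenhageClusterGame x).WinsI) :
    (strongSelectionGame (blades x) (blades x)).WinsII := by
  rw [blades_winsII_iff]
  refine h.transfer (fun _ U => U) (fun _ _ y => y) (fun _ _ _ h => h) fun a y _ hw => ?_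
  refine mem_closure_iff_nhds.2 fun U hU => ?_
  obtain ⟨n, hn⟩ := (mapClusterPt_iff_frequently.1 hw U hU).exists
  exact ⟨y n, hn, mem_range_self n⟩

theorem blades_winsII_denseSets {ℬ : Set (Set X)} (h : (strongSelectionGame (blades x) ℬ).WinsII) :
    (strongSelectionGame (denseSets X) ℬ).WinsII := by
  obtain ⟨σ, hσ⟩ := h
  let ι : denseSets X → blades x := fun D => ⟨D, D.2 x⟩
  refine ⟨fun l => σ (l.map ι), fun a => ?_⟩
  have e : ∀ n, (history a n).map ι = history (ι ∘ a) n := fun n => by simp [history]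
  simp only [e]
  exact hσ (ι ∘ a)

/-- Player I deletes `x` from every move, so `x` is in the closure of the chosen points without
being one of them. The moves remain nonempty because `x` is not isolated. -/
theorem closure_winsI_discrete [T1Space X] [(𝓝[≠] x).NeBot] (h : (closureGame x).WinsI) :
    (discreteSelectionGame X).WinsI := by
  refine h.transfer (fun _ U => ⟨U \ {x}, U.2.1.sdiff isClosed_singleton, ?_⟩) (fun _ _ y => y)
    (fun _ _ _ h => h.1) ?_
  · obtain ⟨y, hy⟩ := U.2.2
    by_cases hyx : y = x
    · subst hyx
      have := (inferInstance : (𝓝[≠] y).NeBot)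
      exact (inter_mem (mem_nhdsWithin_of_mem_nhds (U.2.1.mem_nhds hy))
        self_mem_nhdsWithin |> this.nonempty_of_mem)
    · exact ⟨y, hy, hyx⟩
  · rintro a y hy hw ⟨hc, -⟩
    have hx : x ∈ closure (range y) := hw
    rw [hc.closure_eq] at hx
    obtain ⟨n, hn⟩ := hx
    exact (hy n).2 hn

end Closure

/-! ### Variants of the finite-open game. -/

section FiniteOpen

variable (X : Type*) [TopologicalSpace X]

theorem pointOpen_winsI_finiteOpen (h : (pointOpenGame X).WinsI) : (finiteOpenGame X).WinsI :=
  h.transfer (fun _ x => {x}) (fun _ _ U => U) (fun _ _ _ h => ⟨h.1, h.2 (by simp)⟩)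
    fun _ _ _ hw => hw

theorem finiteOpen_winsI_pointOpen [Nonempty X] (h : (finiteOpenGame X).WinsI) :
    (pointOpenGame X).WinsI := by
  classical
  obtain ⟨σ, hσ⟩ := h
  -- a state consists of the history of the finite-open game, the points of the current finite set
  -- that remain to be played, and the union of the answers to the points already played
  let next : List (Set X) → List (Set X) × List X × Set X := fun l => (l, (σ l).toList, ∅)
  let step : List (Set X) × List X × Set X → Set X → List (Set X) × List X × Set X := fun s U =>
    -- The bound `≤ 1` ends a block with the answer to its last point. It also covers the empty
    -- finite set, which costs one round with an arbitrary point.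
    if s.2.1.length ≤ 1 then next (s.1 ++ [s.2.2 ∪ U]) else (s.1, s.2.1.tail, s.2.2 ∪ U)
  refine WinsI.of_state (next []) step (fun s => s.2.1.headD (Classical.arbitrary X))
    fun U s h0 hs hU => ?_
  -- Every block ends; `V`, the union of its answers, serves as a single answer in the finite-open
  -- game.
  have block : ∀ (p : List X) (n : ℕ) (l : List (Set X)) (W : Set X), s n = (l, p, W) →
      IsOpen W → W ⊆ ⋃ n, U n → ∃ m V, s m = next (l ++ [V]) ∧ IsOpen V ∧ W ⊆ V ∧
        (∀ x ∈ p, x ∈ V) ∧ V ⊆ ⋃ n, U n := by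
    intro p
    induction p with
    | nil =>
      intro n l W hn hW hWU
      refine ⟨n + 1, W ∪ U n, ?_, hW.union (hU n).1, subset_union_left, by simp,
        union_subset hWU (subset_iUnion U n)⟩
      rw [hs, hn]
      simp [step]
    | cons x p ih =>
      intro n l W hn hW hWU
      have hx : x ∈ U n := by simpa [hn] using (hU n).2
      have hWU' := union_subset hWU (subset_iUnion U n)
      rcases p with _ | ⟨y, p⟩
      · refine ⟨n + 1, W ∪ U n, ?_, hW.union (hU n).1, subset_union_left, by simp [hx], hWU'⟩
        rw [hs, hn]
        simp [step]
      · obtain ⟨m, V, hm, hV, hWV, hp, hVU⟩ := ih (n + 1) l (W ∪ U n)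
          (by rw [hs, hn]; simp [step]) (hW.union (hU n).1) hWU'
        refine ⟨m, V, hm, hV, subset_union_left.trans hWV, ?_, hVU⟩
        intro z hz
        rcases List.mem_cons.1 hz with rfl | hz
        · exact hWV (Or.inr hx)
        · exact hp z hz
  obtain ⟨V, hV⟩ := exists_history (R := fun l => ∃ n, s n = next l)
    (P := fun l V => (finiteOpenGame X).legal (σ l) V ∧ V ⊆ ⋃ n, U n) ⟨0, h0⟩ (by
      rintro l ⟨n, hn⟩
      obtain ⟨m, V, hm, hV, -, hp, hVU⟩ := block _ n l ∅ hn isOpen_empty (empty_subset _)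
      exact ⟨V, ⟨m, hm⟩, ⟨hV, fun x hx => hp x (Finset.mem_toList.2 hx)⟩, hVU⟩)
  have hw : (⋃ n, V n) = univ := hσ V fun n => (hV n).1
  exact univ_subset_iff.1 (hw ▸ iUnion_subset fun n => (hV n).2)

/-- The variant of the finite-open game in which player I wins if each point is in all but
finitely many of the open sets. -/
def gammaFiniteOpenGame : OmegaGame (Finset X) (Set X) where
  legal F U := IsOpen U ∧ (F : Set X) ⊆ U
  winI _ U := ∀ x, ∀ᶠ n in atTop, x ∈ U n

/-- If `x` were missed infinitely often, the sets missing it would form a subsequence that does not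
cover `X`, yet every subsequence is won by I. Finite sets are combined by union. -/
theorem finiteOpen_winsI_gamma (h : (finiteOpenGame X).WinsI) :
    (gammaFiniteOpenGame X).WinsI := by
  classical
  obtain ⟨σ, hσ⟩ := h.exists_forall_subseq (fun l => l.foldr (· ∪ ·) ∅) (by
    intro l U hU F hF
    refine ⟨hU.1, Subset.trans ?_ hU.2⟩
    clear hU
    induction l with
    | nil => simp at hF
    | cons E l ih =>
      rw [List.foldr_cons, Finset.coe_union]
      rcases List.mem_cons.1 hF with rfl | hF
      · exact subset_union_left
      · exact (ih hF).trans subset_union_right)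
  refine ⟨σ, fun U hU x => ?_⟩
  by_contra hx
  obtain ⟨k, hk, hkx⟩ := extraction_of_frequently_atTop (not_eventually.1 hx)
  obtain ⟨_, hw⟩ := hσ U hU k hk
  replace hw : (⋃ n, (U ∘ k) n) = univ := hw
  obtain ⟨n, hn⟩ := mem_iUnion.1 (hw ▸ mem_univ x : x ∈ ⋃ n, (U ∘ k) n)
  exact hkx n hn

theorem gamma_winsI_omegaFiniteOpen (h : (gammaFiniteOpenGame X).WinsI) :
    (omegaFiniteOpenGame X).WinsI := by
  refine h.transfer (fun _ F => F) (fun _ _ U => U) (fun _ _ _ h => h) fun a U hU hw => ?_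
  refine ⟨⟨forall_mem_range.2 fun n => (hU n).1, ?_⟩, fun F => ?_⟩
  · rw [sUnion_range]
    exact eq_univ_of_forall fun x => mem_iUnion.2 (hw x).exists
  · obtain ⟨n, hn⟩ := ((Filter.eventually_all_finset F).2 fun x _ => hw x).exists
    exact ⟨U n, mem_range_self n, hn⟩

theorem omegaFiniteOpen_winsI_finiteOpen (h : (omegaFiniteOpenGame X).WinsI) :
    (finiteOpenGame X).WinsI := by
  refine h.transfer (fun _ F => F) (fun _ _ U => U) (fun _ _ _ h => h) fun a U hU hw => ?_
  have : ⋃₀ range U = univ := hw.1.2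
  rwa [sUnion_range] at this

end FiniteOpen

/-! ### Games on `C_p(X)`. -/

section FunctionSpace

variable (X : Type*) [TopologicalSpace X]

theorem gamma_winsI_gruenhageW (h : (gammaFiniteOpenGame X).WinsI) :
    (gruenhageWGame (cpZero X)).WinsI := by
  have hev : ∀ x : X, Continuous fun f : Cp X => f.1 x := fun x =>
    (continuous_apply x).comp continuous_subtype_val
  refine h.transfer
    -- A function small on `F` is read as the open set where it is small; the bound shrinks with the
    -- round, so lying eventually in these sets means convergence to `0`.
    (fun n F => ⟨{f | ∀ x ∈ F, |f.1 x| < 1 / ((n : ℝ) + 1)}, ?_, ?_⟩)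
    (fun n _ f => {x | |f.1 x| < 1 / ((n : ℝ) + 1)}) ?_ ?_
  · simp only [ofPred_forall]
    exact isOpen_biInter_finset fun x _ => isOpen_lt (hev x).abs continuous_const
  · intro x _
    simp only [cpZero, abs_zero]
    positivity
  · intro n F f hf
    exact ⟨isOpen_lt f.2.abs continuous_const, fun x hx => hf x hx⟩
  · intro a f _ hw
    refine tendsto_subtype_rng.2 (tendsto_pi_nhds.2 fun x => ?_)
    exact squeeze_zero_norm' ((hw x).mono fun n hn => le_of_lt hn)
      tendsto_one_div_add_atTop_nhds_zero_nat

theorem gruenhageW_winsI_cluster {Y : Type*} [TopologicalSpace Y] (y : Y)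
    (h : (gruenhageWGame y).WinsI) : (gruenhageClusterGame y).WinsI :=
  h.transfer (fun _ U => U) (fun _ _ y => y) (fun _ _ _ h => h)
    fun _ _ _ hw => Tendsto.mapClusterPt hw

/-- The positive constants `1/(n+1)` converge to zero. This allows deleting the zero function from
the moves of the closure game. -/
instance Cp.nhdsNE_neBot [Nonempty X] : (𝓝[≠] (cpZero X)).NeBot := by
  rw [← mem_closure_iff_nhdsWithin_neBot]
  let u : ℕ → Cp X := fun n => ⟨fun _ => 1 / ((n : ℝ) + 1), continuous_const⟩
  have hu : Tendsto u atTop (𝓝 (cpZero X)) :=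
    tendsto_subtype_rng.2 (tendsto_pi_nhds.2 fun _ => tendsto_one_div_add_atTop_nhds_zero_nat)
  refine mem_closure_of_tendsto hu (Eventually.of_forall fun n hn => ?_)
  have := congrFun (congrArg Subtype.val hn) (Classical.arbitrary X)
  have h2 : (0 : ℝ) < 1 / ((n : ℝ) + 1) := by positivity
  exact h2.ne' this

variable {X}

theorem Cp.exists_finset_forall_eqOn_mem {W : Set (Cp X)} (hW : IsOpen W) {f : Cp X}
    (hf : f ∈ W) : ∃ F : Finset X, ∀ g : Cp X, (∀ x ∈ F, g.1 x = f.1 x) → g ∈ W := by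
  obtain ⟨V, hV, rfl⟩ := isOpen_induced_iff.1 hW
  obtain ⟨F, u, hu, hsub⟩ := isOpen_pi_iff.1 hV f.1 hf
  refine ⟨F, fun g hg => hsub fun x hx => ?_⟩
  rw [hg x hx]
  exact (hu x hx).2

/-- Complete regularity treats one point of `F` at a time; the product over `F` treats all of them.
-/
theorem exists_continuous_zero_on_finset_one_off [CompletelyRegularSpace X] (F : Finset X)
    {U : Set X} (hU : IsOpen U) (hF : (F : Set X) ⊆ U) :
    ∃ h : X → ℝ, Continuous h ∧ (∀ x ∈ F, h x = 0) ∧ ∀ x ∉ U, h x = 1 := by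
  have hex : ∀ x : F, ∃ h : X → ℝ, Continuous h ∧ h x = 0 ∧ ∀ y ∉ U, h y = 1 := by
    intro x
    obtain ⟨h, hc, h0, h1⟩ := CompletelyRegularSpace.completely_regular (x : X) Uᶜ
      hU.isClosed_compl (fun hx => hx (hF x.2))
    refine ⟨fun y => h y, continuous_subtype_val.comp hc, by simp [h0], fun y hy => ?_⟩
    simp [h1 hy]
  choose h hc h0 h1 using hex
  refine ⟨fun y => ∏ x, h x y, continuous_finsetProd _ fun x _ => hc x, fun x hx => ?_,
    fun y hy => Finset.prod_eq_one fun x _ => h1 x y hy⟩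
  exact Finset.prod_eq_zero (Finset.mem_univ ⟨x, hx⟩) (h0 ⟨x, hx⟩)

/-- Evaluation at `x` composed with `g` is the closed embedding of `ℕ` in `ℝ`, which forces `g`
itself to be proper and injective. -/
theorem Cp.isClosed_discrete_range {g : ℕ → Cp X} {x : X} (hg : ∀ n, (g n).1 x = n) :
    IsClosed (range g) ∧ DiscreteTopology (range g) := by
  have hev : Continuous fun f : Cp X => f.1 x :=
    (continuous_apply x).comp continuous_subtype_val
  have hcomp : (fun f : Cp X => f.1 x) ∘ g = ((↑) : ℕ → ℝ) := funext hg
  have hinj : Function.Injective g := Function.Injective.of_comp (hcomp ▸ Nat.cast_injective)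
  have hproper : IsProperMap g := isProperMap_of_comp_of_t2 continuous_of_discreteTopology hev
    (hcomp ▸ Nat.isClosedEmbedding_coe_real.isProperMap)
  have hemb : IsClosedEmbedding g :=
    .of_continuous_injective_isClosedMap hproper.continuous hinj hproper.isClosedMap
  exact ⟨hemb.isClosed_range, hemb.isEmbedding.toHomeomorph.symm.isEmbedding.discreteTopology⟩

variable (X)

theorem discrete_winsI_finiteOpen [CompletelyRegularSpace X]
    (h : (discreteSelectionGame (Cp X)).WinsI) : (finiteOpenGame X).WinsI := by
  have hex : ∀ W : nonemptyOpens (Cp X), ∃ F : Finset X, ∃ f : Cp X,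
      ∀ g : Cp X, (∀ x ∈ F, g.1 x = f.1 x) → g ∈ (W : Set (Cp X)) := by
    rintro ⟨W, hW, f, hf⟩
    obtain ⟨F, hF⟩ := Cp.exists_finset_forall_eqOn_mem hW hf
    exact ⟨F, f, hF⟩
  choose F f hFf using hex
  have hex' : ∀ (n : ℕ) (W : nonemptyOpens (Cp X)) (U : Set X), ∃ g : Cp X,
      (IsOpen U ∧ (F W : Set X) ⊆ U) → g ∈ (W : Set (Cp X)) ∧ ∀ x ∉ U, g.1 x = n := by
    intro n W U
    by_cases hU : IsOpen U ∧ (F W : Set X) ⊆ U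
    · obtain ⟨h, hc, h0, h1⟩ := exists_continuous_zero_on_finset_one_off (F W) hU.1 hU.2
      -- This interpolates between `f W`, where `h = 0`, and the constant `n`, where `h = 1`.
      refine ⟨⟨fun x => (f W).1 x + h x * (n - (f W).1 x), ?_⟩, fun _ => ⟨?_, fun x hx => ?_⟩⟩
      · exact (f W).2.add (hc.mul (continuous_const.sub (f W).2))
      · exact hFf W _ fun x hx => by simp [h0 x hx]
      · simp [h1 x hx]
    · exact ⟨cpZero X, fun h => absurd h hU⟩
  choose g hg using hex'
  refine h.transfer (fun _ W => F W) g (fun n W U hU => (hg n W U hU).1) fun W U hU hw => ?_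
  by_contra hne
  obtain ⟨x, hx⟩ := (ne_univ_iff_exists_notMem _).1 hne
  rw [mem_iUnion, not_exists] at hx
  exact hw (Cp.isClosed_discrete_range fun n => (hg n (W n) (U n) (hU n)).2 x (hx n))

end FunctionSpace

/-! ### The equivalence. -/

theorem theorem14 (X : Type*) [TopologicalSpace X] [T35Space X] [Nonempty X] :
    List.TFAE [
      (strongSelectionGame (openCovers X) (openCovers X)).WinsII,
      (strongSelectionGame (omegaCovers X) (omegaCovers X)).WinsII,
      (pointOpenGame X).WinsI,
      (finiteOpenGame X).WinsI,
      (omegaFiniteOpenGame X).WinsI,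
      (gruenhageWGame (cpZero X)).WinsI,
      (gruenhageClusterGame (cpZero X)).WinsI,
      (closureGame (cpZero X)).WinsI,
      (discreteSelectionGame (Cp X)).WinsI,
      (strongSelectionGame (blades (cpZero X)) (blades (cpZero X))).WinsII,
      (strongSelectionGame (denseSets (Cp X)) (blades (cpZero X))).WinsII] := by
  tfae_have 1 ↔ 3 := rothberger_winsII_iff X
  tfae_have 2 ↔ 5 := omega_rothberger_winsII_iff X
  tfae_have 3 → 4 := pointOpen_winsI_finiteOpen X
  tfae_have 4 → 3 := finiteOpen_winsI_pointOpen X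
  tfae_have 4 → 5 := fun h => gamma_winsI_omegaFiniteOpen X (finiteOpen_winsI_gamma X h)
  tfae_have 5 → 4 := omegaFiniteOpen_winsI_finiteOpen X
  tfae_have 4 → 6 := fun h => gamma_winsI_gruenhageW X (finiteOpen_winsI_gamma X h)
  tfae_have 6 → 7 := gruenhageW_winsI_cluster (cpZero X)
  tfae_have 7 → 10 := cluster_winsI_blades (cpZero X)
  tfae_have 10 → 11 := blades_winsII_denseSets (cpZero X)
  tfae_have 11 ↔ 8 := denseSets_winsII_iff (cpZero X)
  tfae_have 8 → 9 := closure_winsI_discrete (cpZero X)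
  tfae_have 9 → 4 := discrete_winsI_finiteOpen X
  tfae_finish
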